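/- Let $n\ge 1$, $u_{\mathrm m}>0$ and $x_0,x_{\mathrm f}\in\mathbb{R}^n$. Consider the problem of minimizing the free terminal time $t_{\mathrm f}\ge 0$ over measurable inputs $u$ on $[0,t_{\mathrm f}]$ and absolutely continuous trajectories $x=(x_1,\dots,x_n):[0,t_{\mathrm f}]\to\mathbb{R}^n$ subject to $\dot x_1=u$ and $\dot x_k=x_{k-1}$ for $1<k\le n$ (a.e. on $[0,t_{\mathrm f}]$), $x(0)=x_0$, $x(t_{\mathrm f})=x_{\mathrm f}$, $|x_k(t)|\le x_{\mathrm m k}$ for $1\le k\le n$, $t\in[0,t_{\mathrm f}]$, and $|u(t)|\le u_{\mathrm m}$ for a.e. $t\in[0,t_{\mathrm f}]$, where there are no state constraints, i.e. $x_{\mathrm m k}=\infty$ for all $k$. Then every optimal control switches at most $n-1$ times: if $u$ is optimal with minimal time $t_{\mathrm f}$, then there are an integer $0\le m\le n-1$, switching times $0<\tau_1<\dots<\tau_m<t_{\mathrm f}$ and a sign $\varepsilon\in\{1,-1\}$ such that, for almost every $t\in[0,t_{\mathrm f}]$, $$u(t)=\varepsilon\,(-1)^{\#\{i\,:\,\tau_i\le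 t\}}\,u_{\mathrm m}.$$ -/

import Mathlib

open MeasureTheory Set

/-- Right-hand side of the chain of integrators of order `n` with state `y` and input `v`:
`v` for the first coordinate, and the preceding coordinate of `y` for every other one.
The coordinates `x₁, …, xₙ` are indexed by `0, …, n - 1`. -/
def chainField {n : ℕ} (y : Fin n → ℝ) (v : ℝ) (k : Fin n) : ℝ :=
  if (k : ℕ) = 0 then v else y ⟨(k : ℕ) - 1, lt_of_le_of_lt (Nat.sub_le _ _) k.isLt⟩

/-- `(tf, u, x)` is feasible for the chain-of-integrators problem with initial state `x0`,
terminal state `xf`, box state bounds `xm k ∈ [0, ∞]` and input bound `um`.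
Inputs are measurable functions on `[0, tf]`, identified up to null sets; trajectories are
absolutely continuous and satisfy the differential equation almost everywhere. -/
structure ChainFeasible {n : ℕ} (x0 xf : Fin n → ℝ) (xm : Fin n → ENNReal) (um : ℝ)
    (tf : ℝ) (u : ℝ → ℝ) (x : ℝ → Fin n → ℝ) : Prop where
  time_nonneg : 0 ≤ tf
  input_measurable : AEMeasurable u (volume.restrict (Icc 0 tf))
  state_ac : ∀ k, AbsolutelyContinuousOnInterval (fun t => x t k) 0 tf
  dynamics : ∀ᵐ t ∂(volume.restrict (Icc 0 tf)), ∀ k,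
    HasDerivAt (fun s => x s k) (chainField (x t) (u t) k) t
  initial : x 0 = x0
  terminal : x tf = xf
  state_bound : ∀ k, ∀ t ∈ Icc 0 tf, ENNReal.ofReal |x t k| ≤ xm k
  input_bound : ∀ᵐ t ∂(volume.restrict (Icc 0 tf)), |u t| ≤ um

/-- `u` is a time-optimal control, with terminal time `tf` and trajectory `x`: it is feasible,
and no feasible control has a smaller terminal time. -/
def ChainTimeOptimal {n : ℕ} (x0 xf : Fin n → ℝ) (xm : Fin n → ENNReal) (um : ℝ)
    (tf : ℝ) (u : ℝ → ℝ) (x : ℝ → Fin n → ℝ) : Prop :=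
  ChainFeasible x0 xf xm um tf u x ∧
    ∀ (tf' : ℝ) (u' : ℝ → ℝ) (x' : ℝ → Fin n → ℝ),
      ChainFeasible x0 xf xm um tf' u' x' → tf ≤ tf'

/-- On `[0, tf]` the input `u` is, up to a null set, bang-bang with values `um` and `-um`, and
it switches exactly `m` times, at the interior times `τ 0 < ⋯ < τ (m - 1)`: after `j` switching
times have passed, its value is `(-1) ^ j` times its first value `ε * um`, `ε = ±1`. -/
def BangBangSwitches (um tf : ℝ) (u : ℝ → ℝ) (m : ℕ) : Prop :=
  ∃ (τ : Fin m → ℝ) (ε : ℝ), StrictMono τ ∧ (∀ i, τ i ∈ Ioo 0 tf) ∧ (ε = 1 ∨ ε = -1) ∧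
    ∀ᵐ t ∂(volume.restrict (Icc 0 tf)),
      u t = ε * (-1) ^ (Finset.univ.filter fun i => τ i ≤ t).card * um

/-!
Let `T` be the optimal time. The chain of integrators can be solved explicitly: the terminal state
is that of the uncontrolled system (`freeState`) plus the vector of moments
`∫₀ᵀ (T - t)ᵏ / k! · u(t) dt` (`moment`, `moment_eq_of_dynamics`). Without state constraints an
input bounded by `um` is therefore feasible exactly when its moment vector is
`xf - freeState x0 T`, so the question concerns the convex set `reachable n um T` of moment vectors
of all such inputs.

If the moment vector of an optimal input were interior to this set, the target could be reached
sooner. Rescaling time maps the inputs on `[0, s]` onto those on `[0, T]` and acts diagonally on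
moments (`moment_rescale`); hence the target is reachable in time `s` precisely when a vector `d s`,
continuous in `s`, lies in the *fixed* set `reachable n um T`, and this persists for `s` slightly
less than `T` (`exists_feasible_lt_of_mem_interior`).

So the optimal moment vector has a supporting functional (`exists_supporting_functional`). Such a
functional is integration against a nonzero polynomial `p` of degree at most `n - 1`
(`exists_polynomial_of_functional`), and maximality forces `p u = um |p|` almost everywhere
(`ae_eq_of_maximizes`): `u` has the sign of `p`. Finally `p` changes sign at most `n - 1` times
(`exists_sign_pattern`), and these sign changes in `(0, T)` are the switching times.
-/

/-! ### Sign changes of polynomials -/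

/-- The sign of a nonzero polynomial on `[0, T]` alternates at a set `S` of at most `natDegree`
interior points, namely its roots of odd multiplicity in `(0, T)`. At the zeros of the polynomial
the identity says nothing. -/
theorem exists_sign_pattern (T : ℝ) (p : Polynomial ℝ) (hp : p ≠ 0) :
    ∃ (S : Finset ℝ) (ε : ℝ), (ε = 1 ∨ ε = -1) ∧ S.card ≤ p.natDegree ∧
      (∀ s ∈ S, s ∈ Ioo 0 T) ∧
      ∀ t ∈ Icc 0 T, p.eval t = ε * (-1) ^ (S.filter (· ≤ t)).card * |p.eval t| := by
  obtain ⟨d, hd⟩ : ∃ d, p.natDegree = d := ⟨_, rfl⟩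
  induction d generalizing p with
  | zero =>
    obtain ⟨c, rfl⟩ := Polynomial.natDegree_eq_zero.1 hd
    rcases le_total 0 c with hc | hc
    · exact ⟨∅, 1, by simp, by simp, by simp, by simp [abs_of_nonneg hc]⟩
    · exact ⟨∅, -1, by simp, by simp, by simp, by simp [abs_of_nonpos hc]⟩
  | succ d ih =>
    by_cases hr : ∃ r, p.IsRoot r
    · obtain ⟨r, hr⟩ := hr
      obtain ⟨q, rfl⟩ := Polynomial.dvd_iff_isRoot.2 hr
      have hq : q ≠ 0 := right_ne_zero_of_mul hp
      have hdeg : q.natDegree = d := by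
        rw [Polynomial.natDegree_mul (Polynomial.X_sub_C_ne_zero r) hq,
          Polynomial.natDegree_X_sub_C] at hd
        omega
      obtain ⟨S, ε, hε, hcard, hS, hsign⟩ := ih q hq hdeg
      rw [hdeg] at hcard
      rw [hd]
      simp only [Polynomial.eval_mul, Polynomial.eval_sub, Polynomial.eval_X,
        Polynomial.eval_C, abs_mul]
      rcases le_or_gt r 0 with hr0 | hr0
      · refine ⟨S, ε, hε, by omega, hS, fun t ht => ?_⟩
        rw [abs_of_nonneg (by linarith [ht.1] : 0 ≤ t - r)]
        linear_combination (t - r) * hsign t ht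
      rcases le_or_gt T r with hrT | hrT
      · refine ⟨S, -ε, ?_, by omega, hS, fun t ht => ?_⟩
        · rcases hε with rfl | rfl <;> simp
        rw [abs_of_nonpos (by linarith [ht.2] : t - r ≤ 0)]
        linear_combination (t - r) * hsign t ht
      -- An interior root flips the sign to its right: it enters `S` or, if already there,
      -- leaves it.
      have habs : ∀ t, t - r = -(-1) ^ (if r ≤ t then 1 else 0) * |t - r| := by
        intro t
        split_ifs with h
        · rw [abs_of_nonneg (by linarith)]; ring
        · rw [abs_of_nonpos (by linarith)]; ring
      by_cases hrS : r ∈ S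
      · refine ⟨S.erase r, -ε, ?_, (Finset.card_erase_le).trans (by omega),
          fun s hs => hS s (Finset.mem_of_mem_erase hs), fun t ht => ?_⟩
        · rcases hε with rfl | rfl <;> simp
        have hpar : (-1 : ℝ) ^ (S.filter (· ≤ t)).card * (-1) ^ (if r ≤ t then 1 else 0) =
            (-1) ^ ((S.erase r).filter (· ≤ t)).card := by
          rw [Finset.filter_erase]
          split_ifs with h
          · rw [← Finset.card_erase_add_one (Finset.mem_filter.2 ⟨hrS, h⟩)]; ring
          · rw [Finset.erase_eq_of_notMem (by simp [h])]; ring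
        rw [← hpar]
        conv_lhs => rw [habs t, hsign t ht]
        ring
      · refine ⟨insert r S, -ε, ?_, (Finset.card_insert_le _ _).trans (by omega), ?_,
          fun t ht => ?_⟩
        · rcases hε with rfl | rfl <;> simp
        · intro s hs
          rcases Finset.mem_insert.1 hs with rfl | hs
          exacts [⟨hr0, hrT⟩, hS s hs]
        have hpar : (-1 : ℝ) ^ (S.filter (· ≤ t)).card * (-1) ^ (if r ≤ t then 1 else 0) =
            (-1) ^ ((insert r S).filter (· ≤ t)).card := by
          rw [Finset.filter_insert]
          split_ifs with h
          · rw [Finset.card_insert_of_notMem (by simp [hrS])]; ring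
          · ring
        rw [← hpar]
        conv_lhs => rw [habs t, hsign t ht]
        ring
    · have hne : ∀ t, p.eval t ≠ 0 := fun t ht => hr ⟨t, ht⟩
      have hcont : Continuous fun t => p.eval t := p.continuous
      rcases lt_or_gt_of_ne (hne 0) with h0 | h0
      · refine ⟨∅, -1, by simp, by simp, by simp, fun t _ => ?_⟩
        have : p.eval t ≤ 0 := by
          by_contra! h
          obtain ⟨c, hc⟩ := mem_range_of_exists_le_of_exists_ge hcont ⟨0, h0.le⟩ ⟨t, h.le⟩
          exact hne c hc
        simp [abs_of_nonpos this]
      · refine ⟨∅, 1, by simp, by simp, by simp, fun t _ => ?_⟩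
        have : 0 ≤ p.eval t := by
          by_contra! h
          obtain ⟨c, hc⟩ := mem_range_of_exists_le_of_exists_ge hcont ⟨t, h.le⟩ ⟨0, h0.le⟩
          exact hne c hc
        simp [abs_of_nonneg this]

/-- An input whose sign is that of a nonzero polynomial is bang-bang, with at most as many switches
as the degree of the polynomial. -/
theorem bangBangSwitches_of_polynomial {um T : ℝ} {u : ℝ → ℝ} {p : Polynomial ℝ} (hp : p ≠ 0)
    (hu : ∀ᵐ t ∂(volume.restrict (Icc 0 T)), p.eval t * u t = um * |p.eval t|) :
    ∃ m ≤ p.natDegree, BangBangSwitches um T u m := by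
  obtain ⟨S, ε, hε, hcard, hS, hsign⟩ := exists_sign_pattern T p hp
  refine ⟨S.card, hcard, S.orderEmbOfFin rfl, ε, (S.orderEmbOfFin rfl).strictMono,
    fun i => hS _ (S.orderEmbOfFin_mem rfl i), hε, ?_⟩
  have hroots : ∀ᵐ t ∂(volume.restrict (Icc 0 T)), p.eval t ≠ 0 := by
    refine ae_restrict_of_ae ?_
    have : {t | p.eval t = 0}.Finite := by
      refine p.roots.toFinset.finite_toSet.subset fun t ht => ?_
      simpa [hp] using ht
    simpa [ae_iff] using this.measure_zero volume
  filter_upwards [hu, hroots, ae_restrict_mem measurableSet_Icc] with t h1 h2 ht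
  have hcount : (Finset.univ.filter fun i => S.orderEmbOfFin rfl i ≤ t).card =
      (S.filter (· ≤ t)).card := by
    rw [← Finset.card_map (S.orderEmbOfFin rfl).toEmbedding]
    congr 1
    ext s
    simp only [Finset.mem_map, Finset.mem_filter, Finset.mem_univ, true_and]
    constructor
    · rintro ⟨i, hi, rfl⟩
      exact ⟨S.orderEmbOfFin_mem rfl i, hi⟩
    · rintro ⟨hs, hst⟩
      rw [← Finset.mem_coe, ← S.range_orderEmbOfFin rfl] at hs
      obtain ⟨i, rfl⟩ := hs
      exact ⟨i, hst, rfl⟩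
  rw [hcount]
  have h3 := hsign t ht
  set σ : ℝ := ε * (-1) ^ (S.filter (· ≤ t)).card with hσ
  have hσ2 : σ * σ = 1 := by
    have h4 : ε * ε = 1 := by rcases hε with rfl | rfl <;> norm_num
    rw [hσ, mul_mul_mul_comm, h4, ← mul_pow]; norm_num
  apply mul_left_cancel₀ h2
  rw [h1]
  linear_combination (-um * |p.eval t|) * hσ2 - (σ * um) * h3

/-! ### Supporting functionals of convex sets -/

/-- A point of a convex set that is not interior to it has a supporting functional. The set may
have empty interior; as it contains `0`, a functional vanishing on it serves in that case. -/
theorem exists_supporting_functional {E : Type*} [NormedAddCommGroup E] [NormedSpace ℝ E]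
    [FiniteDimensional ℝ E] {K : Set E} (hK : Convex ℝ K) (h0 : 0 ∈ K) {d : E} (hd : d ∈ K)
    (hi : d ∉ interior K) : ∃ f : E →L[ℝ] ℝ, f ≠ 0 ∧ ∀ y ∈ K, f y ≤ f d := by
  by_cases hne : (interior K).Nonempty
  · obtain ⟨f, hf⟩ := geometric_hahn_banach_open_point hK.interior isOpen_interior hi
    refine ⟨f, ?_, fun y hy => ?_⟩
    · rintro rfl
      obtain ⟨a, ha⟩ := hne
      simpa using hf a ha
    · have hcl : closure (interior K) ⊆ {y | f y ≤ f d} :=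
        closure_minimal (fun a ha => (hf a ha).le) (isClosed_le f.continuous continuous_const)
      rw [hK.closure_interior_eq_closure_of_nonempty_interior hne] at hcl
      exact hcl (subset_closure hy)
  · -- `K` has empty interior, so it spans a proper subspace, on which some functional vanishes.
    have hspan : Submodule.span ℝ K < ⊤ := by
      refine lt_top_iff_ne_top.2 fun h => hne (hK.interior_nonempty_iff_affineSpan_eq_top.2 ?_)
      rw [← Set.insert_eq_of_mem h0]
      apply SetLike.coe_injective
      rw [affineSpan_insert_zero, h]
      rfl
    obtain ⟨f, hf, hmap⟩ := Submodule.exists_dual_map_eq_bot_of_lt_top hspan inferInstance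
    have hzero : ∀ y ∈ K, f y = 0 := fun y hy => by
      have : f y ∈ (Submodule.span ℝ K).map f :=
        Submodule.mem_map_of_mem (Submodule.subset_span hy)
      simpa [hmap] using this
    refine ⟨LinearMap.toContinuousLinearMap f, by simpa using hf, fun y hy => ?_⟩
    simp [hzero y hy, hzero d hd]

/-! ### Moments and trajectories of the chain of integrators -/

/-- The normalised moments `∫₀ᵀ (T - t)ᵏ / k! · w(t) dt`, `k < n`, of an input `w` on `[0, T]`:
the contribution of the input to the state at time `T` of the chain of integrators. -/
noncomputable def moment {n : ℕ} (T : ℝ) (w : ℝ → ℝ) (k : Fin n) : ℝ :=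
  ∫ t in 0..T, (T - t) ^ (k : ℕ) / (k : ℕ).factorial * w t

/-- Initial data extended by zero to all natural indices. -/
def extendZero {n : ℕ} (a : Fin n → ℝ) (i : ℕ) : ℝ :=
  if h : i < n then a ⟨i, h⟩ else 0

/-- The state at time `T` of the chain of integrators started at `x0` with zero input. -/
noncomputable def freeState {n : ℕ} (x0 : Fin n → ℝ) (T : ℝ) (k : Fin n) : ℝ :=
  ∑ i ∈ Finset.range ((k : ℕ) + 1),
    T ^ ((k : ℕ) - i) / ((k : ℕ) - i).factorial * extendZero x0 i

theorem continuous_freeState {n : ℕ} (x0 : Fin n → ℝ) : Continuous (freeState x0) := by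
  unfold freeState
  fun_prop

/-- Taylor's formula along a chain of absolutely continuous functions, each the derivative of the
next, by repeated integration by parts: the top coordinate at time `T` in terms of the initial
values and the moment of the derivative of the bottom one. -/
theorem integral_pow_mul_deriv_chain {T : ℝ} (hT : 0 ≤ T) {X : ℕ → ℝ → ℝ} {N : ℕ}
    (hac : ∀ j ≤ N, AbsolutelyContinuousOnInterval (X j) 0 T)
    (hd : ∀ j < N, ∀ᵐ t, t ∈ Icc 0 T → deriv (X (j + 1)) t = X j t) (m j : ℕ) (hj : j + m ≤ N) :
    ∫ t in 0..T, (T - t) ^ m / m.factorial * deriv (X j) t =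
      X (j + m) T - ∑ i ∈ Finset.range (m + 1), T ^ (m - i) / (m - i).factorial * X (j + i) 0 := by
  induction m generalizing j with
  | zero => simpa using (hac j (by omega)).integral_deriv_eq_sub
  | succ m ih =>
    have hker : ∀ t, HasDerivAt (fun t : ℝ => (T - t) ^ (m + 1) / (m + 1).factorial)
        (-((T - t) ^ m / m.factorial)) t := by
      intro t
      have := (((hasDerivAt_id t).const_sub T).pow (m + 1)).div_const ((m + 1).factorial : ℝ)
      refine this.congr_deriv ?_
      rw [Nat.factorial_succ]
      push_cast
      simp only [id]
      field_simp
    have hkac : AbsolutelyContinuousOnInterval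
        (fun t : ℝ => (T - t) ^ (m + 1) / (m + 1).factorial) 0 T := by
      apply ContDiffOn.absolutelyContinuousOnInterval
      fun_prop
    rw [hkac.integral_mul_deriv_eq_deriv_mul (hac j (by omega))]
    have hrec : ∫ t in 0..T, deriv (fun t : ℝ => (T - t) ^ (m + 1) / (m + 1).factorial) t * X j t =
        -∫ t in 0..T, (T - t) ^ m / m.factorial * deriv (X (j + 1)) t := by
      rw [← intervalIntegral.integral_neg]
      refine intervalIntegral.integral_congr_ae ?_
      filter_upwards [hd j (by omega)] with t ht hmem
      rw [uIoc_of_le hT] at hmem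
      rw [(hker t).deriv, ht (Ioc_subset_Icc_self hmem)]
      ring
    rw [hrec, ih (j + 1) (by omega), Finset.sum_range_succ' _ (m + 1)]
    have hsum : ∀ i ∈ Finset.range (m + 1), T ^ (m + 1 - (i + 1)) / (m + 1 - (i + 1)).factorial *
        X (j + (i + 1)) 0 = T ^ (m - i) / (m - i).factorial * X (j + 1 + i) 0 := by
      intro i _
      rw [Nat.add_sub_add_right, show j + (i + 1) = j + 1 + i by omega]
    rw [Finset.sum_congr rfl hsum, show j + 1 + m = j + (m + 1) by omega]
    simp only [sub_self, sub_zero, Nat.sub_zero, add_zero]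
    ring

/-- Variation of constants: the terminal state is the free state plus the moment vector. -/
theorem moment_eq_of_dynamics {n : ℕ} {T : ℝ} (hT : 0 ≤ T) {u : ℝ → ℝ} {x : ℝ → Fin n → ℝ}
    (hac : ∀ k, AbsolutelyContinuousOnInterval (fun t => x t k) 0 T)
    (hdyn : ∀ᵐ t ∂(volume.restrict (Icc 0 T)), ∀ k,
      HasDerivAt (fun s => x s k) (chainField (x t) (u t) k) t) :
    moment T u = x T - freeState (x 0) T := by
  rw [ae_restrict_iff' measurableSet_Icc] at hdyn
  funext k
  have hX : ∀ j (hj : j < n), (fun t => extendZero (x t) j) = fun t => x t ⟨j, hj⟩ := by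
    intro j hj
    funext t
    simp [extendZero, hj]
  have key := integral_pow_mul_deriv_chain hT (X := fun j t => extendZero (x t) j) (N := k)
    (fun j hj => by rw [hX j (by omega)]; exact hac _)
    (fun j hj => by
      filter_upwards [hdyn] with t ht hmem
      rw [hX (j + 1) (by omega), (ht hmem _).deriv]
      simp [chainField, extendZero, show j < n by omega]) k 0 (by omega)
  have hlhs : ∫ t in 0..T, (T - t) ^ (k : ℕ) / (k : ℕ).factorial *
      deriv (fun t => extendZero (x t) 0) t = moment T u k := by
    refine intervalIntegral.integral_congr_ae ?_
    filter_upwards [hdyn] with t ht hmem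
    rw [uIoc_of_le hT] at hmem
    rw [hX 0 k.pos, (ht (Ioc_subset_Icc_self hmem) _).deriv]
    simp [chainField]
  rw [hlhs] at key
  simpa [freeState, extendZero] using key

/-- The trajectory of the chain of integrators from initial data `a` under the input `v`,
obtained by integrating one coordinate after the other. -/
noncomputable def chainTrajectory (a : ℕ → ℝ) (v : ℝ → ℝ) : ℕ → ℝ → ℝ
  | 0 => fun t => a 0 + ∫ s in 0..t, v s
  | k + 1 => fun t => a (k + 1) + ∫ s in 0..t, chainTrajectory a v k s

theorem chainTrajectory_zero (a : ℕ → ℝ) (v : ℝ → ℝ) (k : ℕ) : chainTrajectory a v k 0 = a k := by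
  cases k <;> simp [chainTrajectory]

theorem continuous_chainTrajectory (a : ℕ → ℝ) {v : ℝ → ℝ}
    (hv : ∀ b c, IntervalIntegrable v volume b c) (k : ℕ) :
    Continuous (chainTrajectory a v k) := by
  induction k with
  | zero => exact continuous_const.add (intervalIntegral.continuous_primitive hv 0)
  | succ k ih =>
    exact continuous_const.add
      (intervalIntegral.continuous_primitive (fun b c => ih.intervalIntegrable b c) 0)

/-- Without state constraints, any bounded measurable input with the required moment vector steers
`x0` to `xf` in time `T`. -/
theorem exists_feasible_of_moment_eq {n : ℕ} {x0 xf : Fin n → ℝ} {xm : Fin n → ENNReal}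
    {um T : ℝ} (hxm : ∀ k, xm k = ⊤) (hT : 0 ≤ T) {v : ℝ → ℝ} (hv : Measurable v)
    (hbd : ∀ t, |v t| ≤ um) (hmom : moment T v = xf - freeState x0 T) :
    ∃ x, ChainFeasible x0 xf xm um T v x := by
  have hloc : LocallyIntegrable v := by
    refine (locallyIntegrable_const um).mono hv.aestronglyMeasurable (Filter.Eventually.of_forall ?_)
    intro t
    rw [Real.norm_eq_abs, Real.norm_eq_abs]
    exact (hbd t).trans (le_abs_self um)
  have hint : ∀ b c, IntervalIntegrable v volume b c := fun b c =>
    (intervalIntegrable_const (c := um)).mono_fun' hv.aestronglyMeasurable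
      (Filter.Eventually.of_forall hbd)
  set X := chainTrajectory (extendZero x0) v with hXdef
  have hXc : ∀ k, Continuous (X k) := continuous_chainTrajectory _ hint
  have hac : ∀ k, AbsolutelyContinuousOnInterval (X k) 0 T := by
    intro k
    have hconst : ∀ c : ℝ, AbsolutelyContinuousOnInterval (fun _ => c) 0 T := fun c =>
      ContDiffOn.absolutelyContinuousOnInterval contDiffOn_const
    cases k with
    | zero =>
      exact (hconst _).fun_add
        ((hint 0 T).absolutelyContinuousOnInterval_intervalIntegral left_mem_uIcc)
    | succ k =>
      exact (hconst _).fun_add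
        (((hXc k).intervalIntegrable 0 T).absolutelyContinuousOnInterval_intervalIntegral
          left_mem_uIcc)
  have hdyn : ∀ᵐ t ∂(volume.restrict (Icc 0 T)), ∀ k : Fin n,
      HasDerivAt (fun s => X k s) (chainField (fun i : Fin n => X i t) (v t) k) t := by
    refine ae_restrict_of_ae ?_
    filter_upwards [LocallyIntegrable.ae_hasDerivAt_integral hloc] with t ht k
    obtain ⟨k, hk⟩ := k
    cases k with
    | zero => simpa [chainField, hXdef, chainTrajectory] using (ht 0).const_add (extendZero x0 0)
    | succ k =>
      have := (hXc k).integral_hasStrictDerivAt 0 t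
      simpa [chainField, hXdef, chainTrajectory] using this.hasDerivAt.const_add (extendZero x0 (k + 1))
  have hinit : (fun i : Fin n => X i 0) = x0 := by
    funext i
    simp [hXdef, chainTrajectory_zero, extendZero]
  refine ⟨fun t k => X k t, hT, hv.aemeasurable, fun k => hac k, hdyn, hinit, ?_, ?_,
    Filter.Eventually.of_forall hbd⟩
  · have := moment_eq_of_dynamics hT (x := fun t (k : Fin n) => X k t) (fun k => hac k) hdyn
    rw [hmom, hinit] at this
    exact (sub_left_inj.1 this).symm
  · intro k t _
    simp [hxm]

/-- Stretching an input from `[0, T]` to `[0, s]` scales its moments diagonally. -/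
theorem moment_rescale {n : ℕ} {s T : ℝ} (hs : 0 < s) (hT : 0 < T) (w : ℝ → ℝ) (k : Fin n) :
    moment s (fun t => w (t * (T / s))) k = (s / T) ^ ((k : ℕ) + 1) * moment T w k := by
  have h := intervalIntegral.smul_integral_comp_mul_right (a := 0) (b := s)
    (fun t => (T - t) ^ (k : ℕ) / (k : ℕ).factorial * w t) (T / s)
  rw [zero_mul, mul_div_cancel₀ T hs.ne', smul_eq_mul] at h
  unfold moment
  rw [← h, ← intervalIntegral.integral_const_mul, ← intervalIntegral.integral_const_mul]
  congr 1
  funext t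
  rw [show T - t * (T / s) = (T / s) * (s - t) by field_simp, mul_pow, div_pow, div_pow]
  field_simp
  ring

/-! ### The set of reachable moment vectors -/

/-- The moment vectors of the measurable inputs on `[0, T]` bounded by `um`. -/
def reachable (n : ℕ) (um T : ℝ) : Set (Fin n → ℝ) :=
  {c | ∃ w : ℝ → ℝ, Measurable w ∧ (∀ t, |w t| ≤ um) ∧ moment T w = c}

theorem intervalIntegrable_kernel_mul {um T : ℝ} {w : ℝ → ℝ} (hw : Measurable w)
    (hbd : ∀ t, |w t| ≤ um) {g : ℝ → ℝ} (hg : Continuous g) :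
    IntervalIntegrable (fun t => g t * w t) volume 0 T := by
  have hw' : IntervalIntegrable w volume 0 T :=
    (intervalIntegrable_const (c := um)).mono_fun' hw.aestronglyMeasurable
      (Filter.Eventually.of_forall hbd)
  exact hw'.continuousOn_mul hg.continuousOn

theorem convex_reachable (n : ℕ) (um T : ℝ) : Convex ℝ (reachable n um T) := by
  rintro _ ⟨v, hv, hvb, rfl⟩ _ ⟨w, hw, hwb, rfl⟩ a b ha hb hab
  refine ⟨fun t => a * v t + b * w t, by fun_prop, fun t => ?_, ?_⟩
  · calc |a * v t + b * w t| ≤ a * |v t| + b * |w t| := by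
          refine (abs_add_le _ _).trans ?_
          rw [abs_mul, abs_mul, abs_of_nonneg ha, abs_of_nonneg hb]
      _ ≤ a * um + b * um := by gcongr <;> simp only [hvb, hwb]
      _ = um := by rw [← add_mul, hab, one_mul]
  · funext k
    have hk : Continuous fun t : ℝ => (T - t) ^ (k : ℕ) / (k : ℕ).factorial := by fun_prop
    simp only [moment, Pi.add_apply, Pi.smul_apply, smul_eq_mul]
    rw [← intervalIntegral.integral_const_mul, ← intervalIntegral.integral_const_mul,
      ← intervalIntegral.integral_add
        ((intervalIntegrable_kernel_mul hv hvb hk).const_mul a)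
        ((intervalIntegrable_kernel_mul hw hwb hk).const_mul b)]
    congr 1
    funext t
    ring

theorem zero_mem_reachable (n : ℕ) {um : ℝ} (hum : 0 ≤ um) (T : ℝ) : 0 ∈ reachable n um T :=
  ⟨fun _ => 0, measurable_const, by simpa using hum, by funext k; simp [moment]⟩

/-- If the moment vector needed at time `T` is interior to the reachable set, the target is
reached earlier: rescaling time turns inputs on `[0, s]` into inputs on `[0, T]`, and moves the
required moment vector continuously in `s`. -/
theorem exists_feasible_lt_of_mem_interior {n : ℕ} {x0 xf : Fin n → ℝ} {xm : Fin n → ENNReal}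
    {um T : ℝ} (hxm : ∀ k, xm k = ⊤) (hT : 0 < T)
    (hint : xf - freeState x0 T ∈ interior (reachable n um T)) :
    ∃ s < T, ∃ v x, ChainFeasible x0 xf xm um s v x := by
  let d : ℝ → Fin n → ℝ := fun s k => (T / s) ^ ((k : ℕ) + 1) * (xf k - freeState x0 s k)
  have hd : ContinuousAt d T := by
    have hfree : ∀ k, Continuous fun s => freeState x0 s k := fun k =>
      (continuous_apply k).comp (continuous_freeState x0)
    refine continuousAt_pi.2 fun k => ContinuousAt.mul ?_ ?_
    · exact (continuousAt_const.div continuousAt_id hT.ne').pow _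
    · exact (continuous_const.sub (hfree k)).continuousAt
  have hdT : d T = xf - freeState x0 T := by
    funext k
    simp [d, div_self hT.ne']
  have hev : ∀ᶠ s in nhds T, d s ∈ interior (reachable n um T) :=
    hd.eventually_mem (hdT ▸ isOpen_interior.mem_nhds hint)
  have hev' : ∀ᶠ s in nhdsWithin T (Iio T), d s ∈ interior (reachable n um T) ∧ 0 < s ∧ s < T :=
    (hev.filter_mono nhdsWithin_le_nhds).and
      (((lt_mem_nhds hT).filter_mono nhdsWithin_le_nhds).and self_mem_nhdsWithin)
  obtain ⟨s, hs, hs0, hsT⟩ := hev'.exists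
  obtain ⟨w, hw, hwb, hmom⟩ := interior_subset hs
  refine ⟨s, hsT, fun t => w (t * (T / s)), exists_feasible_of_moment_eq hxm hs0.le
    (hw.comp (measurable_id.mul_const _)) (fun t => hwb _) ?_⟩
  funext k
  rw [moment_rescale hs0 hT, hmom]
  simp only [d, Pi.sub_apply]
  rw [← mul_assoc, ← mul_pow, div_mul_div_cancel₀ hT.ne', div_self hs0.ne', one_pow, one_mul]

/-! ### The switching polynomial -/

/-- A nonzero functional of the moment vector is integration against a nonzero polynomial of
degree less than `n`, the switching function. -/
theorem exists_polynomial_of_functional {n : ℕ} {um T : ℝ}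
    (f : (Fin n → ℝ) →L[ℝ] ℝ) (hf : f ≠ 0) :
    ∃ p : Polynomial ℝ, p ≠ 0 ∧ p.natDegree ≤ n - 1 ∧
      ∀ w : ℝ → ℝ, Measurable w → (∀ t, |w t| ≤ um) →
        f (moment T w) = ∫ t in 0..T, p.eval t * w t := by
  set q : Polynomial ℝ := ∑ k : Fin n,
    Polynomial.monomial (k : ℕ) (f (Pi.single k 1) / (k : ℕ).factorial) with hq
  have hf_apply : ∀ y, f y = ∑ k, y k * f (Pi.single k 1) := by
    intro y
    conv_lhs => rw [pi_eq_sum_univ' y]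
    simp [map_sum]
  have hcoeff : ∀ k : Fin n, q.coeff k = f (Pi.single k 1) / (k : ℕ).factorial := by
    intro k
    simp [hq, Polynomial.finsetSum_coeff, Polynomial.coeff_monomial, Fin.val_inj]
  have hq0 : q ≠ 0 := by
    intro h0
    apply hf
    ext y
    rw [hf_apply y]
    refine Finset.sum_eq_zero fun k _ => ?_
    have := hcoeff k
    rw [h0, Polynomial.coeff_zero, eq_comm, div_eq_zero_iff] at this
    rw [this.resolve_right (by positivity), mul_zero]
  have hlin : (Polynomial.C T - Polynomial.X : Polynomial ℝ).natDegree = 1 := by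
    rw [Polynomial.natDegree_sub, Polynomial.natDegree_X_sub_C]
  refine ⟨q.comp (Polynomial.C T - Polynomial.X), ?_, ?_, fun w hw hbd => ?_⟩
  · intro h
    rcases Polynomial.comp_eq_zero_iff.1 h with h | ⟨-, h⟩
    · exact hq0 h
    · rw [h, Polynomial.natDegree_C] at hlin
      exact zero_ne_one hlin
  · rw [Polynomial.natDegree_comp, hlin, mul_one]
    refine Polynomial.natDegree_sum_le_of_forall_le _ _ fun k _ => ?_
    exact (Polynomial.natDegree_monomial_le _).trans (by omega)
  · rw [hf_apply]
    simp only [moment]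
    have hk : ∀ k : Fin n, Continuous fun t : ℝ => (T - t) ^ (k : ℕ) / (k : ℕ).factorial := by
      intro k
      fun_prop
    simp_rw [← intervalIntegral.integral_mul_const]
    rw [← intervalIntegral.integral_finsetSum fun k _ =>
      (intervalIntegrable_kernel_mul hw hbd (hk k)).mul_const _]
    congr 1
    funext t
    simp only [hq, Polynomial.eval_comp, Polynomial.eval_finsetSum, Polynomial.eval_monomial,
      Polynomial.eval_sub, Polynomial.eval_C, Polynomial.eval_X, Finset.sum_mul]
    refine Finset.sum_congr rfl fun k _ => ?_
    ring

/-- An input maximizing `∫ g w` among the inputs bounded by `um` takes the value `um * sign g`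
almost everywhere off the zeros of `g`. -/
theorem ae_eq_of_maximizes {um T : ℝ} (hT : 0 ≤ T) {u : ℝ → ℝ} (hu : Measurable u)
    (hbd : ∀ t, |u t| ≤ um) {g : ℝ → ℝ} (hg : Continuous g)
    (hmax : ∀ w : ℝ → ℝ, Measurable w → (∀ t, |w t| ≤ um) →
      ∫ t in 0..T, g t * w t ≤ ∫ t in 0..T, g t * u t) :
    ∀ᵐ t ∂(volume.restrict (Icc 0 T)), g t * u t = um * |g t| := by
  have hum : 0 ≤ um := (abs_nonneg _).trans (hbd 0)
  have hsign := hmax (fun t => if 0 ≤ g t then um else -um)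
    (Measurable.ite (measurableSet_le measurable_const hg.measurable)
      measurable_const measurable_const)
    (fun t => by split_ifs <;> simp [abs_of_nonneg hum])
  have habs : ∀ t, g t * (if 0 ≤ g t then um else -um) = um * |g t| := by
    intro t
    split_ifs with h
    · rw [abs_of_nonneg h]; ring
    · rw [abs_of_neg (not_le.1 h)]; ring
  simp_rw [habs] at hsign
  have hi1 : IntervalIntegrable (fun t => um * |g t|) volume 0 T :=
    (hg.abs.const_mul um).intervalIntegrable _ _
  have hi2 := intervalIntegrable_kernel_mul (T := T) hu hbd hg
  have hnonneg : ∀ t, 0 ≤ um * |g t| - g t * u t := by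
    intro t
    rw [sub_nonneg]
    calc g t * u t ≤ |g t * u t| := le_abs_self _
      _ = |g t| * |u t| := abs_mul _ _
      _ ≤ |g t| * um := by gcongr; exact hbd t
      _ = um * |g t| := mul_comm _ _
  have hzero : ∫ t in 0..T, (um * |g t| - g t * u t) = 0 := by
    refine le_antisymm ?_ (intervalIntegral.integral_nonneg hT fun t _ => hnonneg t)
    rw [intervalIntegral.integral_sub hi1 hi2]
    linarith
  rw [intervalIntegral.integral_eq_zero_iff_of_le_of_nonneg_ae hT
    (Filter.Eventually.of_forall hnonneg) (hi1.sub hi2)] at hzero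
  rw [Measure.restrict_congr_set Ioc_ae_eq_Icc.symm]
  filter_upwards [hzero] with t ht
  simp only [Pi.zero_apply] at ht
  linarith

theorem corollary1 (n : ℕ) (hn : 1 ≤ n) (x0 xf : Fin n → ℝ) (xm : Fin n → ENNReal)
    (um : ℝ) (hum : 0 < um) (hxm : ∀ k, xm k = ⊤)
    (tf : ℝ) (u : ℝ → ℝ) (x : ℝ → Fin n → ℝ)
    (hopt : ChainTimeOptimal x0 xf xm um tf u x) :
    ∃ m : ℕ, m ≤ n - 1 ∧ BangBangSwitches um tf u m := by
  obtain ⟨hfeas, hmin⟩ := hopt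
  rcases hfeas.time_nonneg.eq_or_lt with rfl | hT
  · refine ⟨0, Nat.zero_le _, Fin.elim0, 1, fun i => i.elim0, fun i => i.elim0, Or.inl rfl, ?_⟩
    rw [Icc_self, Measure.restrict_singleton, Real.volume_singleton, zero_smul, ae_zero]
    trivial
  -- Replace `u` by an everywhere measurable and bounded representative.
  set v : ℝ → ℝ := fun t => max (-um) (min um (hfeas.input_measurable.mk u t)) with hv
  have hvm : Measurable v :=
    measurable_const.max (measurable_const.min hfeas.input_measurable.measurable_mk)
  have hvb : ∀ t, |v t| ≤ um := fun t =>
    abs_le.2 ⟨le_max_left _ _, max_le (by linarith) (min_le_left _ _)⟩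
  have huv : ∀ᵐ t ∂(volume.restrict (Icc 0 tf)), u t = v t := by
    filter_upwards [hfeas.input_measurable.ae_eq_mk, hfeas.input_bound] with t h1 h2
    obtain ⟨h3, h4⟩ := abs_le.1 h2
    rw [hv]
    simp only [← h1, min_eq_right h4, max_eq_right h3]
  have hmom : moment tf v = xf - freeState x0 tf := by
    have hdyn : ∀ᵐ t ∂(volume.restrict (Icc 0 tf)), ∀ k,
        HasDerivAt (fun s => x s k) (chainField (x t) (v t) k) t := by
      filter_upwards [hfeas.dynamics, huv] with t h1 h2
      rwa [← h2]
    rw [moment_eq_of_dynamics hT.le hfeas.state_ac hdyn, hfeas.terminal, hfeas.initial]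
  have hboundary : moment tf v ∉ interior (reachable n um tf) := by
    intro hint
    rw [hmom] at hint
    obtain ⟨s, hs, w, y, hwy⟩ := exists_feasible_lt_of_mem_interior hxm hT hint
    exact absurd (hmin s w y hwy) (not_le.2 hs)
  obtain ⟨f, hf, hsupp⟩ := exists_supporting_functional (convex_reachable n um tf)
    (zero_mem_reachable n hum.le tf) ⟨v, hvm, hvb, rfl⟩ hboundary
  obtain ⟨p, hp, hdeg, hpf⟩ := exists_polynomial_of_functional (um := um) (T := tf) f hf
  have hpv := ae_eq_of_maximizes hT.le hvm hvb p.continuous fun w hw hwb => by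
    rw [← hpf w hw hwb, ← hpf v hvm hvb]
    exact hsupp _ ⟨w, hw, hwb, rfl⟩
  have hpu : ∀ᵐ t ∂(volume.restrict (Icc 0 tf)), p.eval t * u t = um * |p.eval t| := by
    filter_upwards [hpv, huv] with t h1 h2
    rw [h2, h1]
  obtain ⟨m, hm, hbang⟩ := bangBangSwitches_of_polynomial hp hpu
  exact ⟨m, hm.trans hdeg, hbang⟩
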